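/- Notation. Inequalities between real matrices or vectors are entrywise, and $\rho(\cdot)$ is the spectral radius. A real square matrix is an $M$-matrix if it can be written as $sI-N$ with $N\ge 0$ and $s\ge\rho(N)$; it is a singular $M$-matrix if $s=\rho(N)$ and a nonsingular $M$-matrix if $s>\rho(N)$. An $M$-matrix $K$ is regular if $Kv\ge 0$ for some vector $v>0$. Theorem. Let $m,n\ge 1$, let $A,B,C,D$ be real matrices of sizes $m\times m$, $m\times n$, $n\times m$, $n\times n$, and suppose that $$K=\begin{bmatrix} D & -C\\ -B & A\end{bmatrix}$$ is a regular singular $M$-matrix. Let $\alpha>\max_i a_{ii}$ and $\beta>\max_j d_{jj}$. Then the equation $XCX-XD-AX+B=0$ has a minimal nonnegative solution $\Phi$, and the dual equation $YBY-YA-DY+C=0$ has a minimal nonnegative solution $\Psi$. Put $R=D-C\Phi$ and $S=A-B\Psi$. The alternating-directional doubling algorithm (ADDA) starts from $$\begin{bmatrix} E_0 & -G_0\\ -H_0 & F_0\end{bmatrix}=\begin{bmatrix} D+\alpha I & -C\\ -B & A+\beta I\end{bmatrix}^{-1}\begin{bmatrix} D-\beta I & -C\\ -B & A-\alpha I\end{bmatrix}$$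 and iterates, for $k\ge 0$, $$E_{k+1}=E_k(I-G_kH_k)^{-1}E_k,\qquad F_{k+1}=F_k(I-H_kG_k)^{-1}F_k,$$ $$G_{k+1}=G_k+E_k(I-G_kH_k)^{-1}G_kF_k,\qquad H_{k+1}=H_k+F_k(I-H_kG_k)^{-1}H_kE_k.$$ The ADDA is well defined (all the inverses exist), and $I-G_kH_k$ and $I-H_kG_k$ are nonsingular $M$-matrices for each $k\ge 0$. Moreover, $E_0\le 0$, $F_0\le 0$, and for all $k\ge 1$ $$E_k\ge 0,\quad F_k\ge 0,\quad 0\le H_{k-1}\le H_k\le\Phi,\quad 0\le G_{k-1}\le G_k\le\Psi.$$ Finally, $R+\alpha I$ and $S+\beta I$ are nonsingular and, for every matrix norm $\|\cdot\|$ (that is, any norm on the real vector space of matrices of the given size), $$\limsup_{k\to\infty}\sqrt[2^k]{\|H_k-\Phi\|}\le r(\alpha,\beta),\qquad \limsup_{k\to\infty}\sqrt[2^k]{\|G_k-\Psi\|}\le r(\alpha,\beta),$$ where $$r(\alpha,\beta)=\rho\bigl((R+\alpha I)^{-1}(R-\beta I)\bigr)\cdot\rho\bigl((S+\beta I)^{-1}(S-\alpha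 I)\bigr).$$ -/

import Mathlib

open Matrix Filter

namespace MRiccati

/-- Entrywise order on real matrices: `A ≤ B` iff `a_ij ≤ b_ij` for all `i, j`.
(Mathlib's scoped order on matrices is the Loewner order, which is not meant here.) -/
def EntryLE {p q : Type*} (A B : Matrix p q ℝ) : Prop :=
  ∀ i j, A i j ≤ B i j

/-- Spectral radius of a real square matrix: the largest modulus of a complex eigenvalue. -/
noncomputable def specRad {p : Type*} [Fintype p] [DecidableEq p] (A : Matrix p p ℝ) : ℝ :=
  (spectralRadius ℂ (A.map Complex.ofReal)).toReal

/-- The spectral radius is finite, so that `toReal` in `specRad` loses nothing. -/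
theorem spectralRadius_ne_top {p : Type*} [Fintype p] [DecidableEq p] (A : Matrix p p ℝ) :
    spectralRadius ℂ (A.map Complex.ofReal) ≠ ⊤ := by
  have hfin : (spectrum ℂ (A.map Complex.ofReal)).Finite := Matrix.finite_spectrum _
  obtain ⟨c, hc⟩ := (hfin.image (fun z : ℂ => ‖z‖₊)).bddAbove
  refine ne_top_of_le_ne_top (ENNReal.coe_ne_top (r := c)) ?_
  exact iSup₂_le fun z hz => ENNReal.coe_le_coe.mpr (hc (Set.mem_image_of_mem _ hz))

/-- `A` is an M-matrix: `A = sI - N` with `N ≥ 0` entrywise and `s ≥ ρ(N)`. -/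
def IsMMatrix {p : Type*} [Fintype p] [DecidableEq p] (A : Matrix p p ℝ) : Prop :=
  ∃ (s : ℝ) (N : Matrix p p ℝ), EntryLE 0 N ∧ A = s • (1 : Matrix p p ℝ) - N ∧ specRad N ≤ s

/-- `A` is a singular M-matrix: `A = sI - N` with `N ≥ 0` entrywise and `s = ρ(N)`. -/
def IsSingularMMatrix {p : Type*} [Fintype p] [DecidableEq p] (A : Matrix p p ℝ) : Prop :=
  ∃ (s : ℝ) (N : Matrix p p ℝ), EntryLE 0 N ∧ A = s • (1 : Matrix p p ℝ) - N ∧ specRad N = s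

/-- `A` is a nonsingular M-matrix: `A = sI - N` with `N ≥ 0` entrywise and `s > ρ(N)`. -/
def IsNonsingularMMatrix {p : Type*} [Fintype p] [DecidableEq p] (A : Matrix p p ℝ) : Prop :=
  ∃ (s : ℝ) (N : Matrix p p ℝ), EntryLE 0 N ∧ A = s • (1 : Matrix p p ℝ) - N ∧ specRad N < s

/-- `A` is a regular M-matrix: an M-matrix with `A v ≥ 0` for some entrywise positive `v`. -/
def IsRegularMMatrix {p : Type*} [Fintype p] [DecidableEq p] (A : Matrix p p ℝ) : Prop :=
  IsMMatrix A ∧ ∃ v : p → ℝ, (∀ i, 0 < v i) ∧ ∀ i, 0 ≤ (A *ᵥ v) i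

/-- `X` is the minimal nonnegative solution of `X C X - X D - A X + B = 0`. -/
def IsMinNonnegSol {m n : Type*} [Fintype m] [Fintype n]
    (A : Matrix m m ℝ) (B : Matrix m n ℝ) (C : Matrix n m ℝ) (D : Matrix n n ℝ)
    (X : Matrix m n ℝ) : Prop :=
  EntryLE 0 X ∧ X * C * X - X * D - A * X + B = 0 ∧
    ∀ Y : Matrix m n ℝ, EntryLE 0 Y → Y * C * Y - Y * D - A * Y + B = 0 → EntryLE X Y

/-- One state `(E_k, F_k, G_k, H_k)` of the doubling algorithm. -/
structure ADDAState (m n : Type*) where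
  E : Matrix n n ℝ
  F : Matrix m m ℝ
  G : Matrix n m ℝ
  H : Matrix m n ℝ

/-- The matrix that is inverted in the initialization of the algorithm. -/
def addaInitMatrix {m n : Type*} [DecidableEq m] [DecidableEq n]
    (A : Matrix m m ℝ) (B : Matrix m n ℝ) (C : Matrix n m ℝ) (D : Matrix n n ℝ) (α β : ℝ) :
    Matrix (n ⊕ m) (n ⊕ m) ℝ :=
  fromBlocks (D + α • (1 : Matrix n n ℝ)) (-C) (-B) (A + β • (1 : Matrix m m ℝ))

/-- The block matrix `[E₀, -G₀; -H₀, F₀]`, which is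
`[D + αI, -C; -B, A + βI]⁻¹ [D - βI, -C; -B, A - αI]`. -/
noncomputable def addaInitBlock {m n : Type*} [Fintype m] [Fintype n]
    [DecidableEq m] [DecidableEq n]
    (A : Matrix m m ℝ) (B : Matrix m n ℝ) (C : Matrix n m ℝ) (D : Matrix n n ℝ) (α β : ℝ) :
    Matrix (n ⊕ m) (n ⊕ m) ℝ :=
  (addaInitMatrix A B C D α β)⁻¹ *
    fromBlocks (D - β • (1 : Matrix n n ℝ)) (-C) (-B) (A - α • (1 : Matrix m m ℝ))

/-- One doubling step. -/
noncomputable def addaStep {m n : Type*} [Fintype m] [Fintype n]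
    [DecidableEq m] [DecidableEq n] (σ : ADDAState m n) : ADDAState m n where
  E := σ.E * (1 - σ.G * σ.H)⁻¹ * σ.E
  F := σ.F * (1 - σ.H * σ.G)⁻¹ * σ.F
  G := σ.G + σ.E * (1 - σ.G * σ.H)⁻¹ * σ.G * σ.F
  H := σ.H + σ.F * (1 - σ.H * σ.G)⁻¹ * σ.H * σ.E

/-- The iterates of the alternating-directional doubling algorithm with parameters `α, β`. -/
noncomputable def adda {m n : Type*} [Fintype m] [Fintype n]
    [DecidableEq m] [DecidableEq n]
    (A : Matrix m m ℝ) (B : Matrix m n ℝ) (C : Matrix n m ℝ) (D : Matrix n n ℝ) (α β : ℝ) :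
    ℕ → ADDAState m n
  | 0 =>
    { E := (addaInitBlock A B C D α β).toBlocks₁₁
      F := (addaInitBlock A B C D α β).toBlocks₂₂
      G := -(addaInitBlock A B C D α β).toBlocks₁₂
      H := -(addaInitBlock A B C D α β).toBlocks₂₁ }
  | k + 1 => addaStep (adda A B C D α β k)

/-- `r(α, β) = ρ((R + αI)⁻¹ (R - βI)) · ρ((S + βI)⁻¹ (S - αI))`. -/
noncomputable def addaRate {m n : Type*} [Fintype m] [Fintype n]
    [DecidableEq m] [DecidableEq n]
    (R : Matrix n n ℝ) (S : Matrix m m ℝ) (α β : ℝ) : ℝ :=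
  specRad ((R + α • (1 : Matrix n n ℝ))⁻¹ * (R - β • (1 : Matrix n n ℝ))) *
    specRad ((S + β • (1 : Matrix m m ℝ))⁻¹ * (S - α • (1 : Matrix m m ℝ)))

end MRiccati

/-! Regularity supplies `v = (x, y) > 0` with `K v ≥ 0`; the sign pattern of `K` and this vector
drive every step. Monotone iteration from `0` stays below the bound `X x ≤ y`, which produces `Φ`,
and dually `Ψ`. Let `Q` and `P` be the Cayley transforms of `R` and `S`. The Riccati equation turns
the initialization into `E = (1 - G Φ) Q` and `Φ - H = F Φ Q`; each doubling step preserves these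
relations and squares `Q` (`RiccatiData.addaInitBlock_mul`, `Invariant.halfInvariant_step`). The
dual relations hold with `Ψ` and `P`. Interchanging `(A, B, α, Φ)` and `(D, C, β, Ψ)` maps the
algorithm to itself, so only one half needs proof. Positive diagonals make the inverses exist: `E`
applied to the all-ones vector is positive, which gives `G H u ≤ G Φ u < u` for a positive `u`. For
`k ≥ 1` the error satisfies `0 ≤ Φ - H_k ≤ P ^ 2 ^ k * Φ * Q ^ 2 ^ k`, and Gelfand's formula gives
the rate. -/

namespace MRiccati

/-! ### Entrywise nonnegative matrices. -/

section Nonneg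

variable {p q r : Type*}

theorem entryLE_zero_mul [Fintype q] {A : Matrix p q ℝ} {B : Matrix q r ℝ} (hA : EntryLE 0 A)
    (hB : EntryLE 0 B) : EntryLE 0 (A * B) := fun i j =>
  Finset.sum_nonneg fun k _ => mul_nonneg (hA i k) (hB k j)

theorem entryLE_iff_sub {A B : Matrix p q ℝ} : EntryLE A B ↔ EntryLE 0 (B - A) :=
  forall₂_congr fun _ _ => sub_nonneg.symm

theorem EntryLE.trans {A B C : Matrix p q ℝ} (h₁ : EntryLE A B) (h₂ : EntryLE B C) :
    EntryLE A C := fun i j => (h₁ i j).trans (h₂ i j)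

theorem EntryLE.mul [Fintype q] {A A' : Matrix p q ℝ} {B B' : Matrix q r ℝ} (hA : EntryLE 0 A)
    (hB' : EntryLE 0 B') (hAA : EntryLE A A') (hBB : EntryLE B B') :
    EntryLE (A * B) (A' * B') := fun i j =>
  Finset.sum_le_sum fun k _ => by
    have h₁ : A i k * B k j ≤ A i k * B' k j := mul_le_mul_of_nonneg_left (hBB k j) (hA i k)
    have h₂ : A i k * B' k j ≤ A' i k * B' k j := mul_le_mul_of_nonneg_right (hAA i k) (hB' k j)
    exact h₁.trans h₂

theorem mulVec_mono [Fintype q] {A : Matrix p q ℝ} (hA : EntryLE 0 A) {x y : q → ℝ} (h : ∀ i, x i ≤ y i)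
    (i : p) : (A *ᵥ x) i ≤ (A *ᵥ y) i :=
  Finset.sum_le_sum fun k _ => mul_le_mul_of_nonneg_left (h k) (hA i k)

theorem mulVec_le_mulVec [Fintype q] {A A' : Matrix p q ℝ} (h : EntryLE A A') {x : q → ℝ}
    (hx : ∀ i, 0 ≤ x i) (i : p) : (A *ᵥ x) i ≤ (A' *ᵥ x) i :=
  Finset.sum_le_sum fun k _ => mul_le_mul_of_nonneg_right (h i k) (hx k)

/-- A nonnegative square matrix with positive diagonal. -/
def IsNonnegPosDiag (A : Matrix p p ℝ) : Prop := EntryLE 0 A ∧ ∀ i, 0 < A i i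

theorem IsNonnegPosDiag.mul [Fintype p] {A B : Matrix p p ℝ} (hA : IsNonnegPosDiag A)
    (hB : IsNonnegPosDiag B) : IsNonnegPosDiag (A * B) :=
  ⟨entryLE_zero_mul hA.1 hB.1, fun i =>
    Finset.sum_pos' (fun k _ => mul_nonneg (hA.1 i k) (hB.1 k i))
      ⟨i, Finset.mem_univ i, mul_pos (hA.2 i) (hB.2 i)⟩⟩

theorem IsNonnegPosDiag.mulVec_pos [Fintype p] {A : Matrix p p ℝ} (hA : IsNonnegPosDiag A) {x : p → ℝ}
    (hx : ∀ i, 0 < x i) (i : p) : 0 < (A *ᵥ x) i :=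
  Finset.sum_pos' (fun k _ => mul_nonneg (hA.1 i k) (hx k).le)
    ⟨i, Finset.mem_univ i, mul_pos (hA.2 i) (hx i)⟩

end Nonneg

/-! ### Semipositive Z-matrices, their inverses, and M-matrices. -/

section ZMatrix

variable {p : Type*} [Fintype p]

/-- A matrix with nonpositive off-diagonal entries that maps some positive vector to a
positive vector. -/
def IsSemipositiveZ (M : Matrix p p ℝ) : Prop :=
  (∀ i j, i ≠ j → M i j ≤ 0) ∧ ∃ v : p → ℝ, (∀ i, 0 < v i) ∧ ∀ i, 0 < (M *ᵥ v) i

/-- Minimum principle: at an index `k` minimizing `x j / v j`, the off-diagonal signs give `(M x) k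
≤ (x k / v k) (M v) k`, so a negative minimum would make `(M x) k` negative. -/
theorem IsSemipositiveZ.nonneg_of_mulVec_nonneg {M : Matrix p p ℝ} (hM : IsSemipositiveZ M)
    {x : p → ℝ} (hx : ∀ i, 0 ≤ (M *ᵥ x) i) (i : p) : 0 ≤ x i := by
  obtain ⟨hoff, v, hv, hMv⟩ := hM
  have : Nonempty p := ⟨i⟩
  obtain ⟨k, hk⟩ := Finite.exists_min fun j => x j / v j
  suffices h : 0 ≤ x k / v k by
    simpa using (le_div_iff₀ (hv i)).1 (h.trans (hk i))
  by_contra! hneg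
  have hle : (M *ᵥ x) k ≤ x k / v k * (M *ᵥ v) k := by
    simp only [mulVec, dotProduct, Finset.mul_sum]
    refine Finset.sum_le_sum fun j _ => ?_
    rcases eq_or_ne k j with rfl | hkj
    · have := (hv k).ne'
      apply le_of_eq
      field_simp
    · have h₁ : x k / v k * v j ≤ x j := (le_div_iff₀ (hv j)).1 (hk j)
      have := mul_le_mul_of_nonpos_left h₁ (hoff k j hkj)
      linarith
  have := mul_neg_of_neg_of_pos hneg (hMv k)
  linarith [hx k]

variable [DecidableEq p]

theorem IsSemipositiveZ.isUnit {M : Matrix p p ℝ} (hM : IsSemipositiveZ M) : IsUnit M := by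
  rw [← Matrix.mulVec_injective_iff_isUnit]
  intro x y hxy
  have h₁ := hM.nonneg_of_mulVec_nonneg (x := x - y) (fun i => by
    rw [mulVec_sub, hxy, sub_self]; rfl)
  have h₂ := hM.nonneg_of_mulVec_nonneg (x := y - x) (fun i => by
    rw [mulVec_sub, hxy, sub_self]; rfl)
  funext i
  have a := h₁ i
  have b := h₂ i
  simp only [Pi.sub_apply] at a b
  linarith

theorem IsSemipositiveZ.mul_inv {M : Matrix p p ℝ} (hM : IsSemipositiveZ M) : M * M⁻¹ = 1 :=
  mul_nonsing_inv _ ((isUnit_iff_isUnit_det _).1 hM.isUnit)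

theorem IsSemipositiveZ.inv_mul {M : Matrix p p ℝ} (hM : IsSemipositiveZ M) : M⁻¹ * M = 1 :=
  nonsing_inv_mul _ ((isUnit_iff_isUnit_det _).1 hM.isUnit)

theorem IsSemipositiveZ.inv_nonneg {M : Matrix p p ℝ} (hM : IsSemipositiveZ M) :
    EntryLE 0 M⁻¹ := fun i j => by
  refine hM.nonneg_of_mulVec_nonneg (x := fun k => M⁻¹ k j) (fun k => ?_) i
  have : (M *ᵥ fun k => M⁻¹ k j) k = (M * M⁻¹) k j := rfl
  rw [this, hM.mul_inv, one_apply]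
  split_ifs <;> norm_num

theorem IsSemipositiveZ.inv_isNonnegPosDiag {M : Matrix p p ℝ} (hM : IsSemipositiveZ M) :
    IsNonnegPosDiag M⁻¹ := by
  refine ⟨hM.inv_nonneg, fun i => lt_of_le_of_ne (hM.inv_nonneg i i) fun h0 => ?_⟩
  have h1 : (M * M⁻¹) i i = 1 := by rw [hM.mul_inv, one_apply_eq]
  have h2 : (M * M⁻¹) i i ≤ 0 := Finset.sum_nonpos fun j _ => by
    rcases eq_or_ne i j with rfl | hij
    · exact (mul_eq_zero_of_right _ h0.symm).le
    · exact mul_nonpos_of_nonpos_of_nonneg (hM.1 i j hij) (hM.inv_nonneg j i)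
  linarith

theorem isSemipositiveZ_one_sub {N : Matrix p p ℝ} (hN : EntryLE 0 N) {v : p → ℝ}
    (hv : ∀ i, 0 < v i) (h : ∀ i, (N *ᵥ v) i < v i) : IsSemipositiveZ (1 - N) := by
  refine ⟨fun i j hij => ?_, v, hv, fun i => ?_⟩
  · simpa [one_apply_ne hij] using hN i j
  · simpa [sub_mulVec] using h i

/-- In the maximum norm weighted by `v`, the operator norm of `N` is `max (N v) i / v i < 1`, and
this bounds every complex eigenvalue. -/
theorem isNonsingularMMatrix_one_sub [Nonempty p] {N : Matrix p p ℝ} (hN : EntryLE 0 N)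
    {v : p → ℝ} (hv : ∀ i, 0 < v i) (h : ∀ i, (N *ᵥ v) i < v i) :
    IsNonsingularMMatrix (1 - N) := by
  refine ⟨1, N, hN, by rw [one_smul], ?_⟩
  obtain ⟨k, hk⟩ := Finite.exists_max fun j => (N *ᵥ v) j / v j
  set c := (N *ᵥ v) k / v k with hc
  have hNv : ∀ i, (N *ᵥ v) i ≤ c * v i := fun i => (div_le_iff₀ (hv i)).1 (hk i)
  have hc0 : 0 ≤ c := div_nonneg
    (Finset.sum_nonneg fun j _ => mul_nonneg (hN k j) (hv j).le) (hv k).le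
  have hc1 : c < 1 := (div_lt_one (hv k)).2 (h k)
  refine lt_of_le_of_lt ?_ hc1
  refine ENNReal.toReal_le_of_le_ofReal hc0 (iSup₂_le fun z hz => ?_)
  rw [← enorm_eq_nnnorm, ← ofReal_norm]
  refine ENNReal.ofReal_le_ofReal ?_
  rw [spectrum.mem_iff, ← Matrix.mulVec_injective_iff_isUnit] at hz
  obtain ⟨x, hx0, hx⟩ : ∃ x : p → ℂ, x ≠ 0 ∧ N.map Complex.ofReal *ᵥ x = z • x := by
    by_contra! hne
    refine hz fun x y hxy => ?_
    by_contra hxy'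
    refine hne (x - y) (sub_ne_zero.2 hxy') ?_
    have h0 : (algebraMap ℂ (Matrix p p ℂ) z - N.map Complex.ofReal) *ᵥ (x - y) = 0 := by
      rw [mulVec_sub]; exact sub_eq_zero.2 hxy
    rw [sub_mulVec, sub_eq_zero, Algebra.algebraMap_eq_smul_one, smul_mulVec,
      one_mulVec] at h0
    exact h0.symm
  -- Row `i` of the eigenvalue equation, at the index where the eigenvector attains its weighted
  -- norm, yields `‖z‖ ≤ c`.
  obtain ⟨i, hi⟩ := Finite.exists_max fun j => ‖x j‖ / v j
  have hxi : 0 < ‖x i‖ := by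
    obtain ⟨j, hj⟩ := Function.ne_iff.1 hx0
    have : 0 < ‖x j‖ / v j := div_pos (norm_pos_iff.2 hj) (hv j)
    exact (div_pos_iff_of_pos_right (hv i)).1 (this.trans_le (hi j))
  refine le_of_mul_le_mul_right ?_ hxi
  calc ‖z‖ * ‖x i‖ = ‖(N.map Complex.ofReal *ᵥ x) i‖ := by
        rw [hx, Pi.smul_apply, smul_eq_mul, norm_mul]
    _ ≤ ∑ j, ‖N.map Complex.ofReal i j * x j‖ := norm_sum_le _ _
    _ ≤ ∑ j, ‖x i‖ / v i * (N i j * v j) := by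
        refine Finset.sum_le_sum fun j _ => ?_
        rw [norm_mul, map_apply, Complex.norm_real, Real.norm_of_nonneg (hN i j)]
        have h₁ : ‖x j‖ ≤ ‖x i‖ / v i * v j := (div_le_iff₀ (hv j)).1 (hi j)
        calc N i j * ‖x j‖ ≤ N i j * (‖x i‖ / v i * v j) :=
              mul_le_mul_of_nonneg_left h₁ (hN i j)
          _ = _ := by ring
    _ = ‖x i‖ / v i * (N *ᵥ v) i := by rw [← Finset.mul_sum]; rfl
    _ ≤ ‖x i‖ / v i * (c * v i) :=
        mul_le_mul_of_nonneg_left (hNv i) (div_nonneg hxi.le (hv i).le)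
    _ = c * ‖x i‖ := by have := (hv i).ne'; field_simp

end ZMatrix

/-! ### Convergence rates from Gelfand's formula. -/

section Rate

variable {p q : Type*} [Fintype p] [Fintype q] [DecidableEq p] [DecidableEq q]

attribute [local instance] Matrix.linftyOpNormedAddCommGroup Matrix.linftyOpNormedSpace
  Matrix.linftyOpNormedRing Matrix.linftyOpNormedAlgebra

omit [DecidableEq p] [DecidableEq q] in
theorem norm_entry_le_linfty_opNorm (Y : Matrix p q ℂ) (i : p) (j : q) : ‖Y i j‖ ≤ ‖Y‖ := by
  rw [linfty_opNorm_def]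
  have h₁ : ‖Y i j‖₊ ≤ ∑ l, ‖Y i l‖₊ :=
    Finset.single_le_sum (f := fun l => ‖Y i l‖₊) (fun _ _ => zero_le) (Finset.mem_univ j)
  exact_mod_cast h₁.trans
    (Finset.le_sup (f := fun i => ∑ l, ‖Y i l‖₊) (Finset.mem_univ i))

/-- Expansion in matrix units replaces an arbitrary seminorm, which need not be monotone, by the
operator norm at the cost of a constant. -/
theorem seminorm_le_of_entryLE (ν : Seminorm ℝ (Matrix p q ℝ)) {X Y : Matrix p q ℝ}
    (h0 : EntryLE 0 X) (h : EntryLE X Y) :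
    ν X ≤ (∑ i, ∑ j, ν (single i j 1)) * ‖Y.map Complex.ofReal‖ := by
  conv_lhs => rw [matrix_eq_sum_single X]
  rw [Finset.sum_mul]
  refine (Finset.le_sum_of_subadditive ν (map_zero ν).le (map_add_le_add ν) _ _).trans (Finset.sum_le_sum fun i _ => ?_)
  rw [Finset.sum_mul]
  refine (Finset.le_sum_of_subadditive ν (map_zero ν).le (map_add_le_add ν) _ _).trans (Finset.sum_le_sum fun j _ => ?_)
  have hs : single i j (X i j) = X i j • single i j (1 : ℝ) := by simp
  rw [hs, map_smul_eq_mul, mul_comm]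
  refine mul_le_mul_of_nonneg_left ?_ (apply_nonneg ν _)
  rw [Real.norm_of_nonneg (h0 i j)]
  refine (h i j).trans ((le_abs_self _).trans ?_)
  simpa using norm_entry_le_linfty_opNorm (Y.map Complex.ofReal) i j

theorem tendsto_norm_pow_two_pow_specRad (M : Matrix p p ℝ) :
    Tendsto (fun k : ℕ => ‖(M.map Complex.ofReal) ^ (2 ^ k)‖ ^ ((1 : ℝ) / 2 ^ k)) atTop
      (nhds (specRad M)) := by
  have : CompleteSpace (Matrix p p ℂ) := FiniteDimensional.complete ℂ _
  have h := spectrum.pow_norm_pow_one_div_tendsto_nhds_spectralRadius (M.map Complex.ofReal)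
  have h2 := (ENNReal.tendsto_toReal (spectralRadius_ne_top M)).comp
    (h.comp (tendsto_pow_atTop_atTop_of_one_lt (r := 2) one_lt_two))
  refine h2.congr fun k => ?_
  simp only [Function.comp_apply]
  rw [ENNReal.toReal_ofReal (by positivity)]
  norm_cast

theorem limsup_seminorm_le_specRad_mul (ν : Seminorm ℝ (Matrix p q ℝ)) (S : Matrix p p ℝ)
    (R : Matrix q q ℝ) (Φ : Matrix p q ℝ) (X : ℕ → Matrix p q ℝ)
    (hX0 : ∀ᶠ k in atTop, EntryLE 0 (X k))
    (hX : ∀ᶠ k in atTop, EntryLE (X k) (S ^ (2 ^ k) * Φ * R ^ (2 ^ k))) :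
    limsup (fun k : ℕ => (((ν (X k)) ^ ((1 : ℝ) / 2 ^ k) : ℝ) : EReal)) atTop ≤
      ((specRad S * specRad R : ℝ) : EReal) := by
  -- The summand `1` keeps `c` positive, so that its `2 ^ k`-th roots tend to `1`.
  set c := (∑ i, ∑ j, ν (single i j 1)) * ‖Φ.map Complex.ofReal‖ + 1 with hc
  have hK : 0 ≤ ∑ i, ∑ j, ν (single i j 1) :=
    Finset.sum_nonneg fun i _ => Finset.sum_nonneg fun j _ => apply_nonneg ν _
  have hc0 : 0 < c := by positivity
  have hexp : Tendsto (fun k : ℕ => (1 : ℝ) / 2 ^ k) atTop (nhds 0) := by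
    simpa using tendsto_pow_atTop_nhds_zero_of_lt_one (r := (1 / 2 : ℝ)) (by norm_num) (by norm_num)
  have hlim : Tendsto (fun k : ℕ => c ^ ((1 : ℝ) / 2 ^ k) *
      (‖(S.map Complex.ofReal) ^ (2 ^ k)‖ ^ ((1 : ℝ) / 2 ^ k) *
        ‖(R.map Complex.ofReal) ^ (2 ^ k)‖ ^ ((1 : ℝ) / 2 ^ k))) atTop
      (nhds (specRad S * specRad R)) := by
    have h1 : Tendsto (fun k : ℕ => c ^ ((1 : ℝ) / 2 ^ k)) atTop (nhds 1) := by
      simpa [Function.comp_def] using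
        (Real.continuousAt_const_rpow (b := 0) hc0.ne').tendsto.comp hexp
    simpa using h1.mul
      ((tendsto_norm_pow_two_pow_specRad S).mul (tendsto_norm_pow_two_pow_specRad R))
  have hE := (continuous_coe_real_ereal.tendsto _).comp hlim
  rw [← hE.limsup_eq]
  refine limsup_le_limsup ?_
  filter_upwards [hX0, hX] with k h0 h
  simp only [Function.comp_apply]
  refine EReal.coe_le_coe_iff.2 ?_
  rw [← Real.mul_rpow (norm_nonneg _) (norm_nonneg _),
    ← Real.mul_rpow hc0.le (by positivity)]
  refine Real.rpow_le_rpow (apply_nonneg ν _) ?_ (by positivity)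
  refine (seminorm_le_of_entryLE ν h0 h).trans ?_
  have hmap : (S ^ (2 ^ k) * Φ * R ^ (2 ^ k)).map Complex.ofReal =
      (S.map Complex.ofReal) ^ (2 ^ k) * Φ.map Complex.ofReal *
        (R.map Complex.ofReal) ^ (2 ^ k) := by
    change (S ^ (2 ^ k) * Φ * R ^ (2 ^ k)).map Complex.ofRealHom =
      (S.map Complex.ofRealHom) ^ (2 ^ k) * Φ.map Complex.ofRealHom *
        (R.map Complex.ofRealHom) ^ (2 ^ k)
    rw [Matrix.map_mul, Matrix.map_mul, Matrix.map_pow, Matrix.map_pow]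
  rw [hmap]
  set a := ‖(S.map Complex.ofReal) ^ (2 ^ k)‖
  set b := ‖(R.map Complex.ofReal) ^ (2 ^ k)‖
  have hn : ‖(S.map Complex.ofReal) ^ (2 ^ k) * Φ.map Complex.ofReal *
      (R.map Complex.ofReal) ^ (2 ^ k)‖ ≤ a * ‖Φ.map Complex.ofReal‖ * b :=
    (linfty_opNorm_mul _ _).trans
      (mul_le_mul_of_nonneg_right (linfty_opNorm_mul _ _) (norm_nonneg _))
  have hab : 0 ≤ a * b := mul_nonneg (norm_nonneg _) (norm_nonneg _)
  refine (mul_le_mul_of_nonneg_left hn hK).trans ?_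
  rw [hc]
  linarith

end Rate

/-! ### Existence of the minimal nonnegative solution. -/

section Data

/-- The sign conditions and the inequality `K v ≥ 0`, `v = (x, y) > 0`, for the matrix
`K = [D, -C; -B, A]`. -/
structure RiccatiData {m n : Type*} [Fintype m] [Fintype n] (A : Matrix m m ℝ)
    (B : Matrix m n ℝ) (C : Matrix n m ℝ) (D : Matrix n n ℝ) (x : n → ℝ) (y : m → ℝ) : Prop where
  offdiag_A : ∀ i j, i ≠ j → A i j ≤ 0
  offdiag_D : ∀ i j, i ≠ j → D i j ≤ 0
  nonneg_B : EntryLE 0 B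
  nonneg_C : EntryLE 0 C
  pos_x : ∀ i, 0 < x i
  pos_y : ∀ i, 0 < y i
  le_D : ∀ i, (C *ᵥ y) i ≤ (D *ᵥ x) i
  le_A : ∀ i, (B *ᵥ x) i ≤ (A *ᵥ y) i

variable {m n : Type*} [Fintype m] [Fintype n]
  {A : Matrix m m ℝ} {B : Matrix m n ℝ} {C : Matrix n m ℝ} {D : Matrix n n ℝ}
  {x : n → ℝ} {y : m → ℝ}

theorem RiccatiData.swap (h : RiccatiData A B C D x y) : RiccatiData D C B A y x :=
  ⟨h.offdiag_D, h.offdiag_A, h.nonneg_C, h.nonneg_B, h.pos_y, h.pos_x, h.le_A, h.le_D⟩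

/-- Row `i` of `A y ≥ B x ≥ 0` forces this, since the off-diagonal terms are nonpositive. It makes
`α` and, dually, `β` positive. -/
theorem RiccatiData.diag_A_nonneg [DecidableEq m] (h : RiccatiData A B C D x y) (i : m) :
    0 ≤ A i i := by
  have h1 : 0 ≤ (A *ᵥ y) i := (Finset.sum_nonneg fun j _ =>
    mul_nonneg (h.nonneg_B i j) (h.pos_x j).le).trans (h.le_A i)
  have h2 : (A *ᵥ y) i ≤ A i i * y i := by
    simp only [mulVec, dotProduct]
    rw [← Finset.add_sum_erase _ _ (Finset.mem_univ i)]
    have : ∑ j ∈ Finset.univ.erase i, A i j * y j ≤ 0 := Finset.sum_nonpos fun j hj =>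
      mul_nonpos_of_nonpos_of_nonneg (h.offdiag_A i j (Finset.ne_of_mem_erase hj).symm)
        (h.pos_y j).le
    linarith
  exact nonneg_of_mul_nonneg_left (h1.trans h2) (h.pos_y i)

theorem smul_one_sub_nonneg {p : Type*} [DecidableEq p] {M : Matrix p p ℝ} {c : ℝ}
    (hoff : ∀ i j, i ≠ j → M i j ≤ 0) (hd : ∀ i, M i i ≤ c) :
    EntryLE 0 (c • (1 : Matrix p p ℝ) - M) := fun i j => by
  rcases eq_or_ne i j with rfl | hij
  · simpa using hd i
  · simpa [one_apply_ne hij] using hoff i j hij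

variable [DecidableEq m] [DecidableEq n]

/-- The monotone map whose fixed points are the solutions of the Riccati equation. -/
noncomputable def riccatiMap (A : Matrix m m ℝ) (B : Matrix m n ℝ) (C : Matrix n m ℝ)
    (D : Matrix n n ℝ) (c : ℝ) (X : Matrix m n ℝ) : Matrix m n ℝ :=
  (2 * c)⁻¹ • (X * C * X + X * (c • (1 : Matrix n n ℝ) - D) +
    (c • (1 : Matrix m m ℝ) - A) * X + B)

/-- The equation is shifted by `c • X + c • X` and divided by `2 * c`. Once `c` dominates both
diagonals, the map has nonnegative coefficients and is monotone. -/
theorem riccatiMap_eq_iff {c : ℝ} (hc : 0 < c) {X : Matrix m n ℝ} :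
    riccatiMap A B C D c X = X ↔ X * C * X - X * D - A * X + B = 0 := by
  have h : riccatiMap A B C D c X - X = (2 * c)⁻¹ • (X * C * X - X * D - A * X + B) := by
    have h2 : X = (2 * c)⁻¹ • (c • X + c • X) := by
      rw [← two_smul ℝ (c • X), smul_smul 2 c X, smul_smul, inv_mul_cancel₀ (by positivity),
        one_smul]
    nth_rewrite 2 [h2]
    rw [riccatiMap, ← smul_sub, Matrix.mul_sub, Matrix.sub_mul, Matrix.mul_smul,
      Matrix.smul_mul, Matrix.mul_one, Matrix.one_mul]
    congr 1
    abel
  rw [← sub_eq_zero, h, smul_eq_zero, or_iff_right (by positivity)]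

theorem riccatiMap_mono (h : RiccatiData A B C D x y) {c : ℝ} (hc : 0 < c)
    (hcA : ∀ i, A i i ≤ c) (hcD : ∀ i, D i i ≤ c) {X Y : Matrix m n ℝ} (hX : EntryLE 0 X)
    (hXY : EntryLE X Y) : EntryLE (riccatiMap A B C D c X) (riccatiMap A B C D c Y) := by
  have hY := hX.trans hXY
  have hC' : EntryLE C C := fun _ _ => le_rfl
  have hA := smul_one_sub_nonneg h.offdiag_A hcA
  have hD := smul_one_sub_nonneg h.offdiag_D hcD
  have h1 : EntryLE (X * C * X) (Y * C * Y) := EntryLE.mul (entryLE_zero_mul hX h.nonneg_C) hY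
    (EntryLE.mul hX h.nonneg_C hXY hC') hXY
  have h2 := EntryLE.mul hX hD hXY (fun _ _ => le_rfl)
  have h3 := EntryLE.mul hA hY (fun _ _ => le_rfl) hXY
  intro i j
  simp only [riccatiMap, Matrix.smul_apply, Matrix.add_apply, smul_eq_mul]
  refine mul_le_mul_of_nonneg_left ?_ (by positivity)
  have := h1 i j
  have := h2 i j
  have := h3 i j
  linarith

theorem riccatiMap_nonneg (h : RiccatiData A B C D x y) {c : ℝ} (hc : 0 < c)
    (hcA : ∀ i, A i i ≤ c) (hcD : ∀ i, D i i ≤ c) {X : Matrix m n ℝ} (hX : EntryLE 0 X) :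
    EntryLE 0 (riccatiMap A B C D c X) := by
  refine EntryLE.trans ?_ (riccatiMap_mono h hc hcA hcD (fun _ _ => le_rfl) hX)
  intro i j
  have := h.nonneg_B i j
  simp only [riccatiMap, Matrix.zero_mul, Matrix.mul_zero, zero_add, Matrix.smul_apply,
    smul_eq_mul]
  exact mul_nonneg (by positivity) this

/-- Here `X C X x ≤ X C y ≤ X D x` and `B x ≤ A y`; the terms in `D` and `A` cancel, leaving at most
`2 c y`. -/
theorem riccatiMap_mulVec_le (h : RiccatiData A B C D x y) {c : ℝ} (hc : 0 < c)
    (hcA : ∀ i, A i i ≤ c) {X : Matrix m n ℝ} (hX : EntryLE 0 X)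
    (hXy : ∀ i, (X *ᵥ x) i ≤ y i) (i : m) : (riccatiMap A B C D c X *ᵥ x) i ≤ y i := by
  have hA := smul_one_sub_nonneg h.offdiag_A hcA
  have h1 := mulVec_mono (entryLE_zero_mul hX h.nonneg_C) hXy i
  have h2 := mulVec_mono hA hXy i
  have h3 := mulVec_mono hX h.le_D i
  have h4 := h.le_A i
  have h5 := hXy i
  simp only [riccatiMap, smul_mulVec, add_mulVec, sub_mulVec, one_mulVec, mulVec_mulVec,
    Matrix.mul_sub, Matrix.sub_mul, Matrix.mul_smul, Matrix.smul_mul, Matrix.mul_one,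
    Matrix.one_mul, Pi.add_apply, Pi.sub_apply, Pi.smul_apply, smul_eq_mul] at h1 h2 h3 ⊢
  rw [inv_mul_le_iff₀ (by positivity)]
  have := mul_le_mul_of_nonneg_left h5 hc.le
  linarith

/-- The iterates from `0` increase and are bounded entrywise by `y i / x j`, so they converge to a
fixed point. By induction they stay below every nonnegative solution, hence so does the limit. -/
theorem exists_isMinNonnegSol (h : RiccatiData A B C D x y) :
    ∃ Φ : Matrix m n ℝ, IsMinNonnegSol A B C D Φ ∧ ∀ i, (Φ *ᵥ x) i ≤ y i := by
  obtain ⟨c, hc, hcA, hcD⟩ : ∃ c : ℝ, 0 < c ∧ (∀ i, A i i ≤ c) ∧ ∀ i, D i i ≤ c := by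
    have hA := h.diag_A_nonneg
    have hD := h.swap.diag_A_nonneg
    have sA : 0 ≤ ∑ i, A i i := Finset.sum_nonneg fun i _ => hA i
    have sD : 0 ≤ ∑ i, D i i := Finset.sum_nonneg fun i _ => hD i
    refine ⟨1 + ∑ i, A i i + ∑ i, D i i, by positivity, fun i => ?_, fun i => ?_⟩
    · have : A i i ≤ ∑ i, A i i :=
        Finset.single_le_sum (f := fun i => A i i) (fun i _ => hA i) (Finset.mem_univ i)
      linarith
    · have : D i i ≤ ∑ i, D i i :=
        Finset.single_le_sum (f := fun i => D i i) (fun i _ => hD i) (Finset.mem_univ i)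
      linarith
  set T := riccatiMap A B C D c with hT
  let X : ℕ → Matrix m n ℝ := fun k => T^[k] 0
  have hs : ∀ k, X (k + 1) = T (X k) := fun k => Function.iterate_succ_apply' _ _ _
  have h0 : ∀ k, EntryLE 0 (X k) := fun k => by
    induction k with
    | zero => exact fun _ _ => le_rfl
    | succ k ih => rw [hs]; exact riccatiMap_nonneg h hc hcA hcD ih
  have hmono : ∀ k, EntryLE (X k) (X (k + 1)) := fun k => by
    induction k with
    | zero => exact h0 1
    | succ k ih => rw [hs, hs (k + 1)]; exact riccatiMap_mono h hc hcA hcD (h0 k) ih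
  have hv : ∀ k i, (X k *ᵥ x) i ≤ y i := fun k => by
    induction k with
    | zero =>
      intro i
      simpa [X] using (h.pos_y i).le
    | succ k ih => rw [hs]; exact riccatiMap_mulVec_le h hc hcA (h0 k) ih
  have hb : ∀ i j, BddAbove (Set.range fun k => X k i j) := fun i j => by
    refine ⟨y i / x j, ?_⟩
    rintro _ ⟨k, rfl⟩
    rw [le_div_iff₀ (h.pos_x j)]
    exact (Finset.single_le_sum (f := fun j => X k i j * x j)
      (fun j _ => mul_nonneg (h0 k i j) (h.pos_x j).le) (Finset.mem_univ j)).trans (hv k i)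
  let Φ : Matrix m n ℝ := fun i j => ⨆ k, X k i j
  have hlim : Tendsto X atTop (nhds Φ) := tendsto_pi_nhds.2 fun i => tendsto_pi_nhds.2 fun j =>
    tendsto_atTop_ciSup (monotone_nat_of_le_succ fun k => hmono k i j) (hb i j)
  have hcont : Continuous T := by
    rw [hT]
    unfold riccatiMap
    fun_prop
  have hfix : T Φ = Φ := by
    refine tendsto_nhds_unique ((hcont.tendsto Φ).comp hlim) ?_
    exact ((tendsto_add_atTop_iff_nat 1).2 hlim).congr hs
  refine ⟨Φ, ⟨fun i j => (h0 0 i j).trans (le_ciSup (hb i j) 0),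
    (riccatiMap_eq_iff hc).1 hfix, fun Y hY hYs => ?_⟩, fun i => ?_⟩
  · have hTY : T Y = Y := (riccatiMap_eq_iff hc).2 hYs
    have hXY : ∀ k, EntryLE (X k) Y := fun k => by
      induction k with
      | zero => exact hY
      | succ k ih => rw [hs, ← hTY]; exact riccatiMap_mono h hc hcA hcD (h0 k) ih
    exact fun i j => ciSup_le fun k => hXY k i j
  · have hcv : Continuous fun Z : Matrix m n ℝ => (Z *ᵥ x) i := by fun_prop
    exact le_of_tendsto ((hcv.tendsto Φ).comp hlim) (Eventually.of_forall fun k => hv k i)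

end Data

/-! ### The invariant of a doubling step. -/

section Doubling

variable {m n : Type*}

/-- The state with the roles of the equation and of its dual exchanged. -/
def ADDAState.swap (σ : ADDAState m n) : ADDAState n m := ⟨σ.F, σ.E, σ.H, σ.G⟩

variable [Fintype m] [Fintype n] [DecidableEq m] [DecidableEq n]

/-- The relations between a state of the doubling algorithm, a solution `Φ`
and the current power `R`, together with sign conditions. -/
structure HalfInvariant (Φ : Matrix m n ℝ) (σ : ADDAState m n) (R : Matrix n n ℝ) : Prop where
  nonneg_sol : EntryLE 0 Φ
  posDiag_E : IsNonnegPosDiag σ.E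
  posDiag_R : IsNonnegPosDiag R
  nonneg_H : EntryLE 0 σ.H
  eq_E : σ.E = (1 - σ.G * Φ) * R
  sub_H : Φ - σ.H = σ.F * Φ * R

/-- The relations for the equation and for its dual. -/
structure Invariant (Φ : Matrix m n ℝ) (Ψ : Matrix n m ℝ) (σ : ADDAState m n)
    (R : Matrix n n ℝ) (S : Matrix m m ℝ) : Prop where
  left : HalfInvariant Φ σ R
  right : HalfInvariant Ψ σ.swap S

variable {Φ : Matrix m n ℝ} {Ψ : Matrix n m ℝ} {σ : ADDAState m n} {R : Matrix n n ℝ}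
  {S : Matrix m m ℝ}

theorem Invariant.swap (h : Invariant Φ Ψ σ R S) : Invariant Ψ Φ σ.swap S R := ⟨h.2, h.1⟩

theorem Invariant.sub_H_nonneg (h : Invariant Φ Ψ σ R S) : EntryLE 0 (Φ - σ.H) := by
  rw [h.1.sub_H]
  exact entryLE_zero_mul (entryLE_zero_mul h.2.posDiag_E.1 h.1.nonneg_sol) h.1.posDiag_R.1

theorem Invariant.H_le (h : Invariant Φ Ψ σ R S) : EntryLE σ.H Φ :=
  entryLE_iff_sub.2 h.sub_H_nonneg

/-- Substituting the dual relation `F = (1 - H Ψ) S` into `Φ - H = F Φ R` leaves a nonnegative term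
to discard. -/
theorem Invariant.sub_H_le (h : Invariant Φ Ψ σ R S) : EntryLE (Φ - σ.H) (S * Φ * R) := by
  have hF : σ.F = (1 - σ.H * Ψ) * S := h.2.eq_E
  have hs : S * Φ * R - (Φ - σ.H) = σ.H * Ψ * S * Φ * R := by
    rw [h.1.sub_H, hF, Matrix.sub_mul, Matrix.one_mul, Matrix.sub_mul, Matrix.sub_mul]
    abel
  rw [entryLE_iff_sub, hs]
  exact entryLE_zero_mul (entryLE_zero_mul (entryLE_zero_mul (entryLE_zero_mul h.1.nonneg_H
    h.2.nonneg_sol) h.2.posDiag_R.1) h.1.nonneg_sol) h.1.posDiag_R.1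

theorem Invariant.exists_pos_mulVec_lt (h : Invariant Φ Ψ σ R S) :
    ∃ u : n → ℝ, (∀ i, 0 < u i) ∧ ∀ i, ((σ.G * σ.H) *ᵥ u) i < u i := by
  have hu := h.1.posDiag_R.mulVec_pos (x := fun _ => 1) fun _ => one_pos
  -- With `u = R 1`, positivity of `E 1 = (1 - G Φ) u` says `G Φ u < u`, and `H ≤ Φ` finishes.
  refine ⟨R *ᵥ fun _ => 1, hu, fun i => ?_⟩
  have hE := h.1.posDiag_E.mulVec_pos (x := fun _ => 1) (fun _ => one_pos) i
  rw [h.1.eq_E, ← mulVec_mulVec, sub_mulVec, one_mulVec, Pi.sub_apply, sub_pos] at hE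
  exact (mulVec_le_mulVec (EntryLE.mul h.2.nonneg_H h.1.nonneg_sol (fun _ _ => le_rfl) h.H_le)
    (fun j => (hu j).le) i).trans_lt hE

theorem Invariant.GH_nonneg (h : Invariant Φ Ψ σ R S) : EntryLE 0 (σ.G * σ.H) :=
  entryLE_zero_mul h.2.nonneg_H h.1.nonneg_H

theorem Invariant.isSemipositiveZ (h : Invariant Φ Ψ σ R S) :
    IsSemipositiveZ (1 - σ.G * σ.H) := by
  obtain ⟨u, hu, hlt⟩ := h.exists_pos_mulVec_lt
  exact isSemipositiveZ_one_sub h.GH_nonneg hu hlt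

theorem Invariant.isNonsingularMMatrix [Nonempty n] (h : Invariant Φ Ψ σ R S) :
    IsNonsingularMMatrix (1 - σ.G * σ.H) := by
  obtain ⟨u, hu, hlt⟩ := h.exists_pos_mulVec_lt
  exact isNonsingularMMatrix_one_sub h.GH_nonneg hu hlt

theorem Invariant.H_le_step (h : Invariant Φ Ψ σ R S) : EntryLE σ.H (addaStep σ).H := by
  have hV : IsSemipositiveZ (1 - σ.H * σ.G) := h.swap.isSemipositiveZ
  rw [entryLE_iff_sub]
  simp only [addaStep, add_sub_cancel_left]
  exact entryLE_zero_mul (entryLE_zero_mul (entryLE_zero_mul h.2.posDiag_E.1 hV.inv_nonneg)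
    h.1.nonneg_H) h.1.posDiag_E.1

theorem Invariant.halfInvariant_step (h : Invariant Φ Ψ σ R S) :
    HalfInvariant Φ (addaStep σ) (R * R) where
  nonneg_sol := h.1.nonneg_sol
  posDiag_E := (h.1.posDiag_E.mul h.isSemipositiveZ.inv_isNonnegPosDiag).mul h.1.posDiag_E
  posDiag_R := h.1.posDiag_R.mul h.1.posDiag_R
  nonneg_H := h.1.nonneg_H.trans h.H_le_step
  eq_E := by
    have hW := h.isSemipositiveZ.inv_mul
    have hE := h.1.eq_E
    have hH := h.1.sub_H
    simp only [addaStep]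
    generalize (1 - σ.G * σ.H)⁻¹ = W at *
    -- Splitting `1 - G Φ` as `(1 - G H) - G (Φ - H)` lets `W` cancel its inverse; `Φ - H = F Φ R`
    -- then supplies the second factor `R`.
    have key : (1 - σ.G * σ.H) * R - σ.G * (Φ - σ.H) * R = σ.E := by
      rw [hE]
      simp only [Matrix.sub_mul, Matrix.mul_sub, Matrix.one_mul, Matrix.mul_assoc]
      abel
    have h1 : W * ((1 - σ.G * σ.H) * R) = R := by
      rw [← Matrix.mul_assoc, hW, Matrix.one_mul]
    calc σ.E * W * σ.E = σ.E * (W * ((1 - σ.G * σ.H) * R - σ.G * (Φ - σ.H) * R)) := by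
          rw [key, Matrix.mul_assoc]
      _ = (1 - σ.G * Φ) * R * R - σ.E * W * σ.G * σ.F * Φ * (R * R) := by
        rw [Matrix.mul_sub W, h1, hH, ← hE]
        simp only [Matrix.mul_sub, Matrix.mul_assoc]
      _ = (1 - (σ.G + σ.E * W * σ.G * σ.F) * Φ) * (R * R) := by
        simp only [Matrix.sub_mul, Matrix.add_mul, Matrix.one_mul, Matrix.mul_assoc]
        abel
  sub_H := by
    have hV : IsSemipositiveZ (1 - σ.H * σ.G) := h.swap.isSemipositiveZ
    have hV := hV.inv_mul
    have hE := h.1.eq_E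
    have hH := h.1.sub_H
    simp only [addaStep]
    generalize (1 - σ.H * σ.G)⁻¹ = V at *
    -- The terms `H G Φ R` cancel after `E` is expanded.
    have key : (1 - σ.H * σ.G) * (Φ * R) - σ.H * σ.E = (Φ - σ.H) * R := by
      rw [hE]
      simp only [Matrix.sub_mul, Matrix.mul_sub, Matrix.one_mul, Matrix.mul_assoc]
      abel
    have h1 : V * ((1 - σ.H * σ.G) * (Φ * R)) = Φ * R := by
      rw [← Matrix.mul_assoc, hV, Matrix.one_mul]
    calc Φ - (σ.H + σ.F * V * σ.H * σ.E) = (Φ - σ.H) - σ.F * V * σ.H * σ.E := by abel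
      _ = σ.F * (V * ((1 - σ.H * σ.G) * (Φ * R) - σ.H * σ.E)) := by
        rw [Matrix.mul_sub V, h1, hH]
        simp only [Matrix.mul_sub, Matrix.mul_assoc]
      _ = σ.F * V * σ.F * Φ * (R * R) := by
        rw [key, hH]
        simp only [Matrix.mul_assoc]

theorem Invariant.step (h : Invariant Φ Ψ σ R S) :
    Invariant Φ Ψ (addaStep σ) (R * R) (S * S) :=
  ⟨h.halfInvariant_step, h.swap.halfInvariant_step⟩

end Doubling

/-! ### The initial state and the Cayley transforms. -/

section Init

variable {m n : Type*} [Fintype m] [Fintype n] [DecidableEq m] [DecidableEq n]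
  {A : Matrix m m ℝ} {B : Matrix m n ℝ} {C : Matrix n m ℝ} {D : Matrix n n ℝ}
  {x : n → ℝ} {y : m → ℝ} {α β : ℝ} {Φ : Matrix m n ℝ} {Ψ : Matrix n m ℝ}

theorem isNonnegPosDiag_smul_one_sub {p : Type*} [DecidableEq p] {M : Matrix p p ℝ} {c : ℝ}
    (hoff : ∀ i j, i ≠ j → M i j ≤ 0) (hd : ∀ i, M i i < c) :
    IsNonnegPosDiag (c • (1 : Matrix p p ℝ) - M) :=
  ⟨smul_one_sub_nonneg hoff fun i => (hd i).le, fun i => by simpa using hd i⟩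

theorem addaInitBlock_swap (A : Matrix m m ℝ) (B : Matrix m n ℝ) (C : Matrix n m ℝ)
    (D : Matrix n n ℝ) (α β : ℝ) :
    addaInitBlock D C B A β α =
      (addaInitBlock A B C D α β).submatrix (Equiv.sumComm m n) (Equiv.sumComm m n) := by
  have h1 : addaInitMatrix D C B A β α =
      (addaInitMatrix A B C D α β).submatrix (Equiv.sumComm m n) (Equiv.sumComm m n) :=
    (fromBlocks_submatrix_sum_swap_sum_swap _ _ _ _).symm
  have h2 : fromBlocks (A - α • (1 : Matrix m m ℝ)) (-B) (-C) (D - β • (1 : Matrix n n ℝ)) =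
      (fromBlocks (D - β • (1 : Matrix n n ℝ)) (-C) (-B)
        (A - α • (1 : Matrix m m ℝ))).submatrix (Equiv.sumComm m n) (Equiv.sumComm m n) :=
    (fromBlocks_submatrix_sum_swap_sum_swap _ _ _ _).symm
  rw [addaInitBlock, h1, h2, inv_submatrix_equiv, submatrix_mul_equiv, addaInitBlock]

theorem adda_swap (A : Matrix m m ℝ) (B : Matrix m n ℝ) (C : Matrix n m ℝ)
    (D : Matrix n n ℝ) (α β : ℝ) (k : ℕ) :
    adda D C B A β α k = (adda A B C D α β k).swap := by
  induction k with
  | zero => simp only [adda, addaInitBlock_swap A B C D α β]; rfl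
  | succ k ih => simp only [adda, ih]; rfl

theorem RiccatiData.isSemipositiveZ_addaInitMatrix (h : RiccatiData A B C D x y) (hα : 0 < α)
    (hβ : 0 < β) : IsSemipositiveZ (addaInitMatrix A B C D α β) := by
  refine ⟨?_, Sum.elim x y, ?_, ?_⟩
  · rintro (i | i) (j | j) hij
    · have hne : i ≠ j := fun e => hij (e ▸ rfl)
      simpa [addaInitMatrix, one_apply_ne hne] using h.offdiag_D i j hne
    · simpa [addaInitMatrix] using h.nonneg_C i j
    · simpa [addaInitMatrix] using h.nonneg_B i j
    · have hne : i ≠ j := fun e => hij (e ▸ rfl)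
      simpa [addaInitMatrix, one_apply_ne hne] using h.offdiag_A i j hne
  · rintro (i | i)
    · exact h.pos_x i
    · exact h.pos_y i
  · rintro (i | i)
    · have := h.le_D i
      have := mul_pos hα (h.pos_x i)
      simp [addaInitMatrix, fromBlocks_mulVec, add_mulVec, smul_mulVec, neg_mulVec]
      linarith
    · have := h.le_A i
      have := mul_pos hβ (h.pos_y i)
      simp [addaInitMatrix, fromBlocks_mulVec, add_mulVec, smul_mulVec, neg_mulVec]
      linarith

/-- The negated block is a product of two nonnegative matrices with positive diagonal; the strict
bounds on `α` and `β` give the second factor its positive diagonal. -/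
theorem RiccatiData.isNonnegPosDiag_neg_addaInitBlock (h : RiccatiData A B C D x y)
    (hα : 0 < α) (hβ : 0 < β) (hA : ∀ i, A i i < α) (hD : ∀ j, D j j < β) :
    IsNonnegPosDiag (-addaInitBlock A B C D α β) := by
  rw [addaInitBlock, ← Matrix.mul_neg, fromBlocks_neg, neg_neg, neg_neg, neg_sub, neg_sub]
  refine (h.isSemipositiveZ_addaInitMatrix hα hβ).inv_isNonnegPosDiag.mul ?_
  have h1 := isNonnegPosDiag_smul_one_sub h.offdiag_A hA
  have h2 := isNonnegPosDiag_smul_one_sub h.offdiag_D hD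
  refine ⟨?_, ?_⟩
  · rintro (i | i) (j | j)
    exacts [h2.1 i j, h.nonneg_C i j, h.nonneg_B i j, h1.1 i j]
  · rintro (i | i)
    exacts [h2.2 i, h1.2 i]

/-- `(R + αI)⁻¹ (R - βI)` for `R = D - CΦ`. -/
noncomputable def cayley (R : Matrix n n ℝ) (α β : ℝ) : Matrix n n ℝ :=
  (R + α • (1 : Matrix n n ℝ))⁻¹ * (R - β • (1 : Matrix n n ℝ))

omit [DecidableEq m] [DecidableEq n] in
theorem RiccatiData.offdiag_sub (h : RiccatiData A B C D x y) (hΦ : EntryLE 0 Φ) (i j : n)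
    (hij : i ≠ j) : (D - C * Φ) i j ≤ 0 := by
  have h1 := h.offdiag_D i j hij
  have h2 : 0 ≤ (C * Φ) i j := entryLE_zero_mul h.nonneg_C hΦ i j
  rw [Matrix.sub_apply]
  linarith

omit [DecidableEq m] in
theorem RiccatiData.isSemipositiveZ_sub_add (h : RiccatiData A B C D x y) (hα : 0 < α)
    (hΦ : EntryLE 0 Φ) (hΦx : ∀ i, (Φ *ᵥ x) i ≤ y i) :
    IsSemipositiveZ (D - C * Φ + α • (1 : Matrix n n ℝ)) := by
  refine ⟨fun i j hij => ?_, x, h.pos_x, fun i => ?_⟩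
  · simpa [one_apply_ne hij] using h.offdiag_sub hΦ i j hij
  · have h1 := mulVec_mono h.nonneg_C hΦx i
    have h2 := h.le_D i
    have h3 := mul_pos hα (h.pos_x i)
    simp only [add_mulVec, sub_mulVec, smul_mulVec, one_mulVec, Pi.add_apply, Pi.sub_apply,
      Pi.smul_apply, smul_eq_mul, ← mulVec_mulVec]
    linarith

omit [DecidableEq m] in
theorem RiccatiData.isNonnegPosDiag_neg_cayley (h : RiccatiData A B C D x y) (hα : 0 < α)
    (hΦ : EntryLE 0 Φ) (hΦx : ∀ i, (Φ *ᵥ x) i ≤ y i) (hD : ∀ j, D j j < β) :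
    IsNonnegPosDiag (-cayley (D - C * Φ) α β) := by
  rw [cayley, ← Matrix.mul_neg, neg_sub]
  refine (h.isSemipositiveZ_sub_add hα hΦ hΦx).inv_isNonnegPosDiag.mul
    (isNonnegPosDiag_smul_one_sub (h.offdiag_sub hΦ) fun i => ?_)
  have h2 : 0 ≤ (C * Φ) i i := entryLE_zero_mul h.nonneg_C hΦ i i
  rw [Matrix.sub_apply]
  linarith [hD i]

/-- The initial state with the signs of `E` and `F` reversed. -/
noncomputable def addaNegInit (A : Matrix m m ℝ) (B : Matrix m n ℝ) (C : Matrix n m ℝ)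
    (D : Matrix n n ℝ) (α β : ℝ) : ADDAState m n :=
  ⟨-(adda A B C D α β 0).E, -(adda A B C D α β 0).F, (adda A B C D α β 0).G,
    (adda A B C D α β 0).H⟩

/-- With `R = D - C Φ` the Riccati equation reads `A Φ - B = -Φ R`. Both block rows then reduce to
`(R + αI) Q = R - βI`, the lower one multiplied by `Φ` on the left. -/
theorem RiccatiData.addaInitBlock_mul (h : RiccatiData A B C D x y) (hα : 0 < α) (hβ : 0 < β)
    (hΦ : EntryLE 0 Φ) (hΦx : ∀ i, (Φ *ᵥ x) i ≤ y i)
    (heq : Φ * C * Φ - Φ * D - A * Φ + B = 0) :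
    addaInitBlock A B C D α β * (fromRows 1 (-(Φ * cayley (D - C * Φ) α β)) : Matrix (n ⊕ m) n ℝ) =
      fromRows (cayley (D - C * Φ) α β) (-Φ) := by
  have hM := h.isSemipositiveZ_addaInitMatrix hα hβ
  have hR : (D - C * Φ + α • (1 : Matrix n n ℝ)) * cayley (D - C * Φ) α β =
      D - C * Φ - β • (1 : Matrix n n ℝ) := by
    rw [cayley, ← Matrix.mul_assoc, (h.isSemipositiveZ_sub_add hα hΦ hΦx).mul_inv,
      Matrix.one_mul]
  set Q := cayley (D - C * Φ) α β
  have hΦR : Φ * ((D - C * Φ + α • (1 : Matrix n n ℝ)) * Q) =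
      Φ * (D - C * Φ - β • (1 : Matrix n n ℝ)) := by rw [hR]
  have hAΦ : A * Φ = Φ * C * Φ - Φ * D + B := by
    rw [← sub_eq_zero, ← neg_eq_zero, ← heq]; abel
  have hAΦQ : A * (Φ * Q) = (Φ * C * Φ - Φ * D + B) * Q := by rw [← Matrix.mul_assoc, hAΦ]
  suffices hs : fromBlocks (D - β • (1 : Matrix n n ℝ)) (-C) (-B) (A - α • (1 : Matrix m m ℝ)) *
      (fromRows 1 (-(Φ * Q)) : Matrix (n ⊕ m) n ℝ) =
        addaInitMatrix A B C D α β * (fromRows Q (-Φ) : Matrix (n ⊕ m) n ℝ) by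
    rw [addaInitBlock, Matrix.mul_assoc, hs, ← Matrix.mul_assoc, hM.inv_mul, Matrix.one_mul]
  rw [addaInitMatrix, fromBlocks_mul_fromRows, fromBlocks_mul_fromRows, fromRows_ext_iff]
  simp only [Matrix.sub_mul, Matrix.mul_sub, Matrix.add_mul, Matrix.mul_add, Matrix.mul_neg,
    Matrix.neg_mul, Matrix.mul_one, Matrix.one_mul, Matrix.smul_mul, Matrix.mul_smul, neg_neg,
    Matrix.mul_assoc] at hR hΦR hAΦ hAΦQ ⊢
  constructor
  · linear_combination (norm := module) -hR
  · linear_combination (norm := module) hΦR + hAΦ - hAΦQ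

theorem RiccatiData.halfInvariant_addaNegInit (h : RiccatiData A B C D x y) (hα : 0 < α)
    (hβ : 0 < β) (hA : ∀ i, A i i < α) (hD : ∀ j, D j j < β) (hΦ : EntryLE 0 Φ)
    (hΦx : ∀ i, (Φ *ᵥ x) i ≤ y i) (heq : Φ * C * Φ - Φ * D - A * Φ + B = 0) :
    HalfInvariant Φ (addaNegInit A B C D α β) (-cayley (D - C * Φ) α β) := by
  have hP := h.isNonnegPosDiag_neg_addaInitBlock hα hβ hA hD
  have hT := h.addaInitBlock_mul hα hβ hΦ hΦx heq
  have hQ := h.isNonnegPosDiag_neg_cayley hα hΦ hΦx hD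
  set Q := cayley (D - C * Φ) α β
  rw [← fromBlocks_toBlocks (addaInitBlock A B C D α β), fromBlocks_mul_fromRows,
    fromRows_ext_iff] at hT
  obtain ⟨h1, h2⟩ := hT
  refine ⟨hΦ, ⟨fun i j => hP.1 (Sum.inl i) (Sum.inl j), fun i => hP.2 (Sum.inl i)⟩, hQ,
    fun i j => hP.1 (Sum.inr i) (Sum.inl j), ?_, ?_⟩
  · simp only [addaNegInit, adda]
    simp only [Matrix.sub_mul, Matrix.mul_neg, Matrix.neg_mul, Matrix.mul_one, Matrix.one_mul,
      Matrix.mul_assoc] at h1 ⊢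
    linear_combination (norm := module) -h1
  · simp only [addaNegInit, adda]
    simp only [Matrix.mul_neg, Matrix.neg_mul, Matrix.mul_one, Matrix.mul_assoc] at h2 ⊢
    linear_combination (norm := module) h2

theorem RiccatiData.invariant_addaNegInit (h : RiccatiData A B C D x y) (hα : 0 < α)
    (hβ : 0 < β) (hA : ∀ i, A i i < α) (hD : ∀ j, D j j < β) (hΦ : IsMinNonnegSol A B C D Φ)
    (hΦx : ∀ i, (Φ *ᵥ x) i ≤ y i) (hΨ : IsMinNonnegSol D C B A Ψ)
    (hΨy : ∀ i, (Ψ *ᵥ y) i ≤ x i) :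
    Invariant Φ Ψ (addaNegInit A B C D α β) (-cayley (D - C * Φ) α β)
      (-cayley (A - B * Ψ) β α) := by
  refine ⟨h.halfInvariant_addaNegInit hα hβ hA hD hΦ.1 hΦx hΦ.2.1, ?_⟩
  have := h.swap.halfInvariant_addaNegInit hβ hα hD hA hΨ.1 hΨy hΨ.2.1
  rwa [addaNegInit, adda_swap] at this

/-- Up to the signs of `E₀` and `F₀`, all iterates satisfy the invariant. -/
theorem exists_invariant_adda {R₀ : Matrix n n ℝ} {S₀ : Matrix m m ℝ}
    (h : Invariant Φ Ψ (addaNegInit A B C D α β) (-R₀) (-S₀)) (k : ℕ) :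
    ∃ (τ : ADDAState m n) (R : Matrix n n ℝ) (S : Matrix m m ℝ), Invariant Φ Ψ τ R S ∧
      τ.G = (adda A B C D α β k).G ∧ τ.H = (adda A B C D α β k).H ∧
      addaStep τ = adda A B C D α β (k + 1) ∧
      R * R = R₀ ^ 2 ^ (k + 1) ∧ S * S = S₀ ^ 2 ^ (k + 1) := by
  induction k with
  | zero =>
    -- Every term involving `E` or `F` in a step contains exactly two such factors, so the
    -- sign-reversed initial state has the same successor. Only the squares of `-R₀` and `-S₀`
    -- enter, which is why the powers are recorded for `R * R` and `S * S`.
    refine ⟨_, _, _, h, rfl, rfl, ?_, ?_, ?_⟩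
    · simp [addaStep, adda, addaNegInit]
    · simp [pow_two]
    · simp [pow_two]
  | succ k ih =>
    obtain ⟨τ, R, S, hI, -, -, hs, hR, hS⟩ := ih
    have hI' := hI.step
    rw [hs] at hI'
    refine ⟨_, _, _, hI', rfl, rfl, rfl, ?_, ?_⟩
    · rw [hR, ← pow_two, ← pow_mul, ← pow_succ]
    · rw [hS, ← pow_two, ← pow_mul, ← pow_succ]

end Init

/-! ### From a regular M-matrix to the main theorem. -/

theorem exists_riccatiData {m n : Type*} [Fintype m] [Fintype n] [DecidableEq m] [DecidableEq n]
    {A : Matrix m m ℝ} {B : Matrix m n ℝ} {C : Matrix n m ℝ} {D : Matrix n n ℝ}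
    (h : IsRegularMMatrix (fromBlocks D (-C) (-B) A)) :
    ∃ (x : n → ℝ) (y : m → ℝ), RiccatiData A B C D x y := by
  obtain ⟨⟨s, N, hN, hK, -⟩, v, hv, hKv⟩ := h
  have hoff : ∀ a b, a ≠ b → fromBlocks D (-C) (-B) A a b ≤ 0 := fun a b hab => by
    simpa [hK, one_apply_ne hab] using hN a b
  refine ⟨v ∘ Sum.inl, v ∘ Sum.inr, ?_, ?_, ?_, ?_, fun i => hv _, fun i => hv _, ?_, ?_⟩
  · exact fun i j hij => hoff (Sum.inr i) (Sum.inr j) (Sum.inr_injective.ne hij)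
  · exact fun i j hij => hoff (Sum.inl i) (Sum.inl j) (Sum.inl_injective.ne hij)
  · exact fun i j => neg_nonpos.1 (hoff (Sum.inr i) (Sum.inl j) Sum.inr_ne_inl)
  · exact fun i j => neg_nonpos.1 (hoff (Sum.inl i) (Sum.inr j) Sum.inl_ne_inr)
  · intro i
    have := hKv (Sum.inl i)
    simp only [fromBlocks_mulVec, Sum.elim_inl, Pi.add_apply, neg_mulVec, Pi.neg_apply] at this
    linarith
  · intro i
    have := hKv (Sum.inr i)
    simp only [fromBlocks_mulVec, Sum.elim_inr, Pi.add_apply, neg_mulVec, Pi.neg_apply] at this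
    linarith

end MRiccati

theorem mainTheorem10 {m n : Type*} [Fintype m] [Fintype n] [DecidableEq m] [DecidableEq n]
    [Nonempty m] [Nonempty n]
    (A : Matrix m m ℝ) (B : Matrix m n ℝ) (C : Matrix n m ℝ) (D : Matrix n n ℝ)
    (hreg : MRiccati.IsRegularMMatrix (Matrix.fromBlocks D (-C) (-B) A))
    (hsing : MRiccati.IsSingularMMatrix (Matrix.fromBlocks D (-C) (-B) A))
    (α β : ℝ) (hα : ∀ i, A i i < α) (hβ : ∀ j, D j j < β) :
    -- the minimal nonnegative solutions of the equation and of its dual equation exist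
    ∃ (Φ : Matrix m n ℝ) (Ψ : Matrix n m ℝ),
      MRiccati.IsMinNonnegSol A B C D Φ ∧
      MRiccati.IsMinNonnegSol D C B A Ψ ∧
      -- the algorithm is well defined
      IsUnit (MRiccati.addaInitMatrix A B C D α β) ∧
      (∀ k, IsUnit (1 - (MRiccati.adda A B C D α β k).G * (MRiccati.adda A B C D α β k).H) ∧
        IsUnit (1 - (MRiccati.adda A B C D α β k).H * (MRiccati.adda A B C D α β k).G)) ∧
      (∀ k, MRiccati.IsNonsingularMMatrix
          (1 - (MRiccati.adda A B C D α β k).G * (MRiccati.adda A B C D α β k).H) ∧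
        MRiccati.IsNonsingularMMatrix
          (1 - (MRiccati.adda A B C D α β k).H * (MRiccati.adda A B C D α β k).G)) ∧
      -- signs and monotonicity
      MRiccati.EntryLE (MRiccati.adda A B C D α β 0).E 0 ∧
      MRiccati.EntryLE (MRiccati.adda A B C D α β 0).F 0 ∧
      (∀ k, MRiccati.EntryLE 0 (MRiccati.adda A B C D α β (k + 1)).E ∧
        MRiccati.EntryLE 0 (MRiccati.adda A B C D α β (k + 1)).F) ∧
      (∀ k, MRiccati.EntryLE 0 (MRiccati.adda A B C D α β k).H ∧
        MRiccati.EntryLE (MRiccati.adda A B C D α β k).H (MRiccati.adda A B C D α β (k + 1)).H ∧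
        MRiccati.EntryLE (MRiccati.adda A B C D α β (k + 1)).H Φ) ∧
      (∀ k, MRiccati.EntryLE 0 (MRiccati.adda A B C D α β k).G ∧
        MRiccati.EntryLE (MRiccati.adda A B C D α β k).G (MRiccati.adda A B C D α β (k + 1)).G ∧
        MRiccati.EntryLE (MRiccati.adda A B C D α β (k + 1)).G Ψ) ∧
      -- the inverses in the rate exist, and the rate bounds hold in every matrix norm
      IsUnit ((D - C * Φ) + α • (1 : Matrix n n ℝ)) ∧
      IsUnit ((A - B * Ψ) + β • (1 : Matrix m m ℝ)) ∧
      (∀ ν : Seminorm ℝ (Matrix m n ℝ), (∀ X, ν X = 0 → X = 0) →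
        Filter.limsup (fun k : ℕ =>
            (((ν ((MRiccati.adda A B C D α β k).H - Φ)) ^ ((1 : ℝ) / 2 ^ k) : ℝ) : EReal))
          Filter.atTop ≤ ((MRiccati.addaRate (D - C * Φ) (A - B * Ψ) α β : ℝ) : EReal)) ∧
      (∀ ν : Seminorm ℝ (Matrix n m ℝ), (∀ Y, ν Y = 0 → Y = 0) →
        Filter.limsup (fun k : ℕ =>
            (((ν ((MRiccati.adda A B C D α β k).G - Ψ)) ^ ((1 : ℝ) / 2 ^ k) : ℝ) : EReal))
          Filter.atTop ≤ ((MRiccati.addaRate (D - C * Φ) (A - B * Ψ) α β : ℝ) : EReal)) := by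
  obtain ⟨x, y, h⟩ := MRiccati.exists_riccatiData hreg
  obtain ⟨Φ, hΦ, hΦx⟩ := MRiccati.exists_isMinNonnegSol h
  obtain ⟨Ψ, hΨ, hΨy⟩ := MRiccati.exists_isMinNonnegSol h.swap
  have hα0 : 0 < α := (h.diag_A_nonneg (Classical.arbitrary m)).trans_lt (hα _)
  have hβ0 : 0 < β := (h.swap.diag_A_nonneg (Classical.arbitrary n)).trans_lt (hβ _)
  have hinit := h.invariant_addaNegInit hα0 hβ0 hα hβ hΦ hΦx hΨ hΨy
  have hinv := MRiccati.exists_invariant_adda hinit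
  -- From index `1` on, the iterates themselves satisfy the invariant, with no sign correction.
  have hsucc : ∀ k, MRiccati.Invariant Φ Ψ (MRiccati.adda A B C D α β (k + 1))
      (MRiccati.cayley (D - C * Φ) α β ^ 2 ^ (k + 1))
      (MRiccati.cayley (A - B * Ψ) β α ^ 2 ^ (k + 1)) := fun k => by
    obtain ⟨τ, R, S, hI, -, -, hs, hR, hS⟩ := hinv k
    rw [← hs, ← hR, ← hS]
    exact hI.step
  refine ⟨Φ, Ψ, hΦ, hΨ, (h.isSemipositiveZ_addaInitMatrix hα0 hβ0).isUnit, fun k => ?_,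
    fun k => ?_, fun i j => ?_, fun i j => ?_, fun k => ?_, fun k => ?_, fun k => ?_,
    (h.isSemipositiveZ_sub_add hα0 hΦ.1 hΦx).isUnit,
    (h.swap.isSemipositiveZ_sub_add hβ0 hΨ.1 hΨy).isUnit, fun ν _ => ?_, fun ν _ => ?_⟩
  · obtain ⟨τ, R, S, hI, hG, hH, -⟩ := hinv k
    rw [← hG, ← hH]
    exact ⟨hI.isSemipositiveZ.isUnit, hI.swap.isSemipositiveZ.isUnit⟩
  · obtain ⟨τ, R, S, hI, hG, hH, -⟩ := hinv k
    rw [← hG, ← hH]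
    exact ⟨hI.isNonsingularMMatrix, hI.swap.isNonsingularMMatrix⟩
  · exact neg_nonneg.1 (hinit.1.posDiag_E.1 i j)
  · exact neg_nonneg.1 (hinit.2.posDiag_E.1 i j)
  · exact ⟨(hsucc k).1.posDiag_E.1, (hsucc k).2.posDiag_E.1⟩
  · obtain ⟨τ, R, S, hI, hG, hH, hs, -⟩ := hinv k
    rw [← hH, ← hs]
    exact ⟨hI.1.nonneg_H, hI.H_le_step, hI.step.H_le⟩
  · obtain ⟨τ, R, S, hI, hG, hH, hs, -⟩ := hinv k
    rw [← hG, ← hs]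
    exact ⟨hI.2.nonneg_H, hI.swap.H_le_step, hI.step.swap.H_le⟩
  -- The error is turned into the nonnegative `Φ - H_k`. Its bound carries the `S` factor first,
  -- hence the commutation of the rate.
  · simp_rw [map_sub_rev ν _ Φ]
    rw [MRiccati.addaRate, mul_comm]
    refine MRiccati.limsup_seminorm_le_specRad_mul ν _ _ Φ _ ?_ ?_
    · filter_upwards [eventually_ge_atTop 1] with k hk
      obtain ⟨k, rfl⟩ := Nat.exists_eq_add_of_le' hk
      exact (hsucc k).sub_H_nonneg
    · filter_upwards [eventually_ge_atTop 1] with k hk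
      obtain ⟨k, rfl⟩ := Nat.exists_eq_add_of_le' hk
      exact (hsucc k).sub_H_le
  · simp_rw [map_sub_rev ν _ Ψ]
    refine MRiccati.limsup_seminorm_le_specRad_mul ν _ _ Ψ _ ?_ ?_
    · filter_upwards [eventually_ge_atTop 1] with k hk
      obtain ⟨k, rfl⟩ := Nat.exists_eq_add_of_le' hk
      exact (hsucc k).swap.sub_H_nonneg
    · filter_upwards [eventually_ge_atTop 1] with k hk
      obtain ⟨k, rfl⟩ := Nat.exists_eq_add_of_le' hk
      exact (hsucc k).swap.sub_H_le
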